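/- Let $0\le\varepsilon\le 1$, let $X$ be a uniform random bit, let $Z$ be the output of the binary symmetric channel BSC$(\varepsilon)$ with input $X$, and let $\bar Z$ be the output of the binary erasure channel BEC$(4\varepsilon(1-\varepsilon))$ (erasure probability $4\varepsilon(1-\varepsilon)$) with input $X$. Logarithms are natural, and $\log 0=-\infty$. For a sequence of functions $f_n:\mathbf F_2^n\to\mathcal S_n$ into finite sets, put $S_n=f_n(X^n)$, and let $I(S_n;Z^n)$ be the mutual information, where $(X^n,Z^n)$ are $n$ i.i.d. copies of $(X,Z)$. For $R\ge 0$ let $$E(R;X|Z)=\sup\Big\{\liminf_{n\to\infty}-\tfrac1n\log I(S_n;Z^n)\ :\ \liminf_{n\to\infty}\tfrac1n\log|\mathcal S_n|\ge R\Big\},$$ where the supremum is over the sequences $(f_n)$ in one of the following classes: (i) those for which each $S_n$ is uniform on $\mathcal S_n$; (ii) the linear ones, $\mathcal S_n=\mathbf F_2^{k_n}$ and $f_n(x)=xM_n^T$ with $M_n$ a $k_n\times n$ matrix of rank $k_n$; (iii) all sequences. Define $E(R;X|\bar Z)$ in the same way. Let $$E_x(R,a)=\sup_{\theta\ge1}\theta\big\{\log2-R-\log(1+a^{1/\theta})\big\},\qquad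 E_r(R;X|Z)=\max_{0\le\theta\le1}\Big[-\log\sum_{x,z}P_{XZ}(x,z)^{1+\theta}P_Z(z)^{-\theta}-\theta R\Big].$$ Then, for each of the three classes and every $0\le R\le\log 2$, $$E(R;X|Z)\ \ge\ E(R;X|\bar Z)\ \ge\ E_x(R,1-4\varepsilon(1-\varepsilon)).$$ Moreover, there are a smallest rate $R_x(\varepsilon)\ge0$ at which the supremum in $E_x(R,1-4\varepsilon(1-\varepsilon))$ is attained at $\theta=1$ and a largest rate $R_{cr}(\varepsilon)\ge0$ at which the maximum in $E_r(R;X|Z)$ is attained at $\theta=1$. They satisfy $R_x(\varepsilon)\le R_{cr}(\varepsilon)$, and $R_x(\varepsilon)>0$ if $0<\varepsilon<1$. One has $E_x(R,1-4\varepsilon(1-\varepsilon))=E_r(R;X|Z)$ for $R_x(\varepsilon)\le R\le R_{cr}(\varepsilon)$, and $E_x(R,1-4\varepsilon(1-\varepsilon))>E_r(R;X|Z)$ for $0\le R<R_x(\varepsilon)$. -/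

import Mathlib

open Filter

noncomputable section

namespace PrivacyAmp

/-- Joint distribution of a uniform bit `X` and the output `Z` of the binary symmetric channel
with crossover probability `ε` and input `X`. -/
def bscSource (ε : ℝ) (x z : ZMod 2) : ℝ :=
  if z = x then (1 - ε) / 2 else ε / 2

/-- Joint distribution of a uniform bit `X` and the output `Z` of the binary erasure channel
with erasure probability `δ` and input `X`; the erasure symbol is `none`. -/
def becSource (δ : ℝ) (x : ZMod 2) : Option (ZMod 2) → ℝ
  | none => δ / 2
  | some y => if y = x then (1 - δ) / 2 else 0

/-- The memoryless extension `P_{XZ}^n`. -/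
def iid {X Z : Type} (P : X → Z → ℝ) (n : ℕ) (x : Fin n → X) (z : Fin n → Z) : ℝ :=
  ∏ i, P (x i) (z i)

/-- Joint distribution `P_{SZ}` of `S = f(X)` and `Z`, for `(X, Z)` with distribution `P`. -/
def keyJoint {X Z S : Type} [Fintype X] [DecidableEq S] (P : X → Z → ℝ) (f : X → S)
    (s : S) (z : Z) : ℝ :=
  ∑ x with f x = s, P x z

/-- Mutual information, in nats, of a joint distribution on a finite set
(terms with `Q s z = 0` contribute `0`). -/
def mutualInfo {S Z : Type} [Fintype S] [Fintype Z] (Q : S → Z → ℝ) : ℝ :=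
  ∑ s, ∑ z, Q s z * Real.log (Q s z / ((∑ z', Q s z') * ∑ s', Q s' z))

/-- A sequence of functions `f_n : 𝔽₂ⁿ → 𝒮_n`, with `|𝒮_n| = size n`. -/
structure HashSequence where
  size : ℕ → ℕ
  hash : ∀ n, (Fin n → ZMod 2) → Fin (size n)

namespace HashSequence

/-- The rate `liminf (1/n) log |𝒮_n|`. -/
def rate (F : HashSequence) : EReal :=
  liminf (fun n : ℕ => ((Real.log (F.size n) / n : ℝ) : EReal)) atTop

/-- The leaked information `I(f_n) = I(S_n; Zⁿ)`. -/
def leakedInfo {Z : Type} [Fintype Z] (P : ZMod 2 → Z → ℝ) (F : HashSequence) (n : ℕ) : ℝ :=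
  mutualInfo (keyJoint (iid P n) (F.hash n))

/-- `liminf -(1/n) log I(f_n)`, where `log 0 = -∞`. -/
def leakageExponent {Z : Type} [Fintype Z] (P : ZMod 2 → Z → ℝ) (F : HashSequence) : EReal :=
  liminf (fun n : ℕ => -ENNReal.log (ENNReal.ofReal (F.leakedInfo P n)) / (n : EReal)) atTop

/-- The sequences for which the key `S_n = f_n(Xⁿ)` is uniform on `𝒮_n`
when `Xⁿ` is uniform on `𝔽₂ⁿ`. -/
def uniformKey : Set HashSequence :=
  {F | ∀ n, ∀ s : Fin (F.size n),
    ((Finset.univ.filter fun x => F.hash n x = s).card : ℝ) / 2 ^ n = 1 / F.size n}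

/-- The sequences of linear functions `x ↦ x Mᵀ` onto `𝒮_n = 𝔽₂ᵏ`, with `M` a `k × n` matrix of
rank `k`, where `k` may depend on `n`; `e` identifies `𝔽₂ᵏ` with `{0, …, 2ᵏ - 1}`. -/
def linear : Set HashSequence :=
  {F | ∀ n, ∃ (k : ℕ) (M : Matrix (Fin k) (Fin n) (ZMod 2))
    (e : (Fin k → ZMod 2) ≃ Fin (F.size n)),
      M.rank = k ∧ ∀ x, F.hash n x = e (Matrix.vecMul x M.transpose)}

end HashSequence

/-- The optimal exponent `E(R; X|Z)` of the leaked information over the sequences in `𝒞`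
that have rate at least `R`. -/
def optimalExponent {Z : Type} [Fintype Z] (𝒞 : Set HashSequence) (P : ZMod 2 → Z → ℝ)
    (R : ℝ) : EReal :=
  sSup {E | ∃ F ∈ 𝒞, (R : EReal) ≤ F.rate ∧ E = F.leakageExponent P}

/-- The function of `θ` that is maximized in `E_x(R, a)`. -/
def expurgationObjective (R a θ : ℝ) : ℝ :=
  θ * (Real.log 2 - R - Real.log (1 + a ^ (1 / θ)))

/-- The expurgation exponent `E_x(R, a)` of the binary erasure channel with erasure
probability `a`. -/
def expurgationExponent (R a : ℝ) : EReal :=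
  ⨆ θ ∈ Set.Ici (1 : ℝ), (expurgationObjective R a θ : EReal)

/-- `ψ(θ; X|Z)` for `(X, Z)` with joint distribution `P`. -/
def psi {X Z : Type} [Fintype X] [Fintype Z] (P : X → Z → ℝ) (θ : ℝ) : ℝ :=
  -Real.log (∑ x, ∑ z, P x z ^ (1 + θ) * (∑ x', P x' z) ^ (-θ))

/-- The function of `θ` that is maximized in Hayashi's exponent `E_r(R; X|Z)`. -/
def hayashiObjective {X Z : Type} [Fintype X] [Fintype Z] (P : X → Z → ℝ) (R θ : ℝ) : ℝ :=
  psi P θ - θ * R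

/-- Hayashi's exponent `E_r(R; X|Z)`. -/
def hayashiExponent {X Z : Type} [Fintype X] [Fintype Z] (P : X → Z → ℝ) (R : ℝ) : EReal :=
  ⨆ θ ∈ Set.Icc (0 : ℝ) 1, (hayashiObjective P R θ : EReal)

/-- The rates for which the maximum in `E_r(R; X|Z)` is achieved by `θ = 1`, where `Z` is the
output of the binary symmetric channel with crossover probability `ε`. -/
def hayashiTightRates (ε : ℝ) : Set ℝ :=
  {R | 0 ≤ R ∧ IsMaxOn (hayashiObjective (bscSource ε) R) (Set.Icc 0 1) 1}

/-- The rates for which the maximum in `E_x(R, 1 - 4 ε (1 - ε))` is achieved by `θ = 1`. -/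
def expurgationTightRates (ε : ℝ) : Set ℝ :=
  {R | 0 ≤ R ∧ IsMaxOn (expurgationObjective R (1 - 4 * ε * (1 - ε))) (Set.Ici 1) 1}

/-- The critical rate `R_cr(ε)`. -/
def criticalRate (ε : ℝ) : ℝ := sSup (hayashiTightRates ε)

/-- The expurgation rate `R_x(ε)`. -/
def expurgationRate (ε : ℝ) : ℝ := sInf (expurgationTightRates ε)

end PrivacyAmp

end

namespace PrivacyAmp

open Real

/-! Write a = (1 - 2ε)² = 1 - 4ε(1-ε) for the probability that the erasure channel keeps its input.

First inequality. The erasure channel is less noisy than the symmetric one: for every S with S - Xⁿ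
- (outputs), its output says at least as much about S. For one letter this is the subadditivity of
`channelGap`, the homogeneous extension of the convex function p ↦ h(ε + (1-2ε)p) - (1-2ε)² h(p). It
tensorizes by replacing the letters one at a time (`outputNegEntropy_bsc_le`). So each hash sequence
has at least as large an exponent on the symmetric side.

Second inequality. For a linear hash, log t ≤ t - 1 bounds the information by a χ² quantity, which
Parseval turns into the sum of a^{wt(v)} over the nonzero words v of the row space
(`mutualInfo_linear_bec_le`). Averaging the weights a^{wt(v)/θ} over a family of codes and raising
the resulting bound to the power θ gives the expurgation exponent. Linear hashes of full rank have
uniform keys, so one construction serves all three classes.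

Comparison. At θ = 1 the two objectives agree, because 1 + a = 2((1-ε)² + ε²). Both are concave in
θ, so optimality of θ = 1 is governed by the sign of the slope there; Gibbs' inequality supplies the
tangent bounds. That some rate R makes θ = 1 optimal for both reduces to an inequality between two
binary entropies (`log_two_le_binEntropy_add`), which follows from h(x) ≥ 4 log 2 · x(1-x). -/

theorem zmod_two_eq : ∀ x : ZMod 2, x = 0 ∨ x = 1 := by decide

theorem sum_zmod_two (f : ZMod 2 → ℝ) : ∑ x, f x = f 0 + f 1 := Fin.sum_univ_two f

/-! ### One-letter comparison of the symmetric and erasure channels -/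

/-- The entropy of the output of a binary symmetric channel, minus `(1 - 2ε)²` times the entropy
of its input, is a convex function of the input distribution. -/
theorem convexOn_binEntropy_bsc_sub {ε : ℝ} (h0 : 0 ≤ ε) (h1 : ε ≤ 1) :
    ConvexOn ℝ (Set.Icc 0 1)
      (fun p => binEntropy (ε + (1 - 2 * ε) * p) - (1 - 2 * ε) ^ 2 * binEntropy p) := by
  have hq : ∀ p ∈ Set.Ioo (0 : ℝ) 1, 0 < ε + (1 - 2 * ε) * p ∧ ε + (1 - 2 * ε) * p < 1 := by
    rintro p ⟨hp0, hp1⟩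
    constructor
    · rcases h0.eq_or_lt with rfl | h
      · simpa using hp0
      · nlinarith [mul_pos h (sub_pos.2 hp1), mul_nonneg (sub_nonneg.2 h1) hp0.le]
    · rcases h0.eq_or_lt with rfl | h
      · simpa using hp1
      · nlinarith [mul_pos h hp0, mul_nonneg (sub_nonneg.2 h1) (sub_pos.2 hp1).le]
  refine convexOn_of_hasDerivWithinAt2_nonneg (convex_Icc 0 1) (by fun_prop)
    (f' := fun p => (1 - 2 * ε) * (log (1 - (ε + (1 - 2 * ε) * p)) - log (ε + (1 - 2 * ε) * p))
      - (1 - 2 * ε) ^ 2 * (log (1 - p) - log p))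
    (f'' := fun p => (1 - 2 * ε) ^ 2 * (1 / (p * (1 - p))
      - 1 / ((ε + (1 - 2 * ε) * p) * (1 - (ε + (1 - 2 * ε) * p))))) ?_ ?_ ?_
  · intro p hp
    rw [interior_Icc] at hp ⊢
    obtain ⟨hq0, hq1⟩ := hq p hp
    have hlin : HasDerivAt (fun p : ℝ => ε + (1 - 2 * ε) * p) (1 - 2 * ε) p := by
      simpa using ((hasDerivAt_id p).const_mul (1 - 2 * ε)).const_add ε
    have := ((hasDerivAt_binEntropy hq0.ne' hq1.ne).comp p hlin).sub
      ((hasDerivAt_binEntropy hp.1.ne' hp.2.ne).const_mul ((1 - 2 * ε) ^ 2))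
    refine (this.congr_deriv ?_).hasDerivWithinAt
    ring
  · intro p hp
    rw [interior_Icc] at hp ⊢
    obtain ⟨hq0, hq1⟩ := hq p hp
    have hlin : HasDerivAt (fun p : ℝ => ε + (1 - 2 * ε) * p) (1 - 2 * ε) p := by
      simpa using ((hasDerivAt_id p).const_mul (1 - 2 * ε)).const_add ε
    have hp0 : p ≠ 0 := hp.1.ne'
    have hp1 : 1 - p ≠ 0 := (sub_pos.2 hp.2).ne'
    have hq0' := hq0.ne'
    have hq1' := (sub_pos.2 hq1).ne'
    have := (((hlin.const_sub 1).log hq1').sub (hlin.log hq0')).const_mul (1 - 2 * ε) |>.sub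
      (((((hasDerivAt_id p).const_sub 1).log hp1).sub ((hasDerivAt_id p).log hp0)).const_mul
        ((1 - 2 * ε) ^ 2))
    refine (this.congr_deriv ?_).hasDerivWithinAt
    simp only [id]
    generalize ε + (1 - 2 * ε) * p = q at *
    field_simp
    ring
  · intro p hp
    rw [interior_Icc] at hp
    obtain ⟨hq0, hq1⟩ := hq p hp
    have hpp : 0 < p * (1 - p) := mul_pos hp.1 (sub_pos.2 hp.2)
    refine mul_nonneg (sq_nonneg _) (sub_nonneg.2 (one_div_le_one_div_of_le hpp ?_))
    -- With q = ε + (1-2ε)p, one has q(1-q) - p(1-p) = ε(1-ε)(1-2p)².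
    nlinarith [mul_nonneg (mul_nonneg h0 (sub_nonneg.2 h1)) (sq_nonneg (1 - 2 * p))]

/-- The gap between the entropies of the outputs of the two channels with input weights `(a, b)`. -/
noncomputable def channelGap (ε a b : ℝ) : ℝ :=
  negMulLog ((1 - ε) * a + ε * b) + negMulLog (ε * a + (1 - ε) * b)
    - (1 - 2 * ε) ^ 2 * (negMulLog a + negMulLog b) - 4 * ε * (1 - ε) * negMulLog (a + b)

/-- The terms in `negMulLog t` cancel because (1-2ε)² + 4ε(1-ε) = 1, so the gap is homogeneous of
degree one: the perspective of the convex function above. -/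
theorem channelGap_eq {t : ℝ} (ε p : ℝ) :
    channelGap ε (t * (1 - p)) (t * p) =
      t * (binEntropy (ε + (1 - 2 * ε) * p) - (1 - 2 * ε) ^ 2 * binEntropy p) := by
  have e1 : (1 - ε) * (t * (1 - p)) + ε * (t * p) = t * (1 - (ε + (1 - 2 * ε) * p)) := by ring
  have e2 : ε * (t * (1 - p)) + (1 - ε) * (t * p) = t * (ε + (1 - 2 * ε) * p) := by ring
  have e3 : t * (1 - p) + t * p = t := by ring
  rw [channelGap, e1, e2, e3]
  simp only [negMulLog_mul, binEntropy_eq_negMulLog_add_negMulLog_one_sub]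
  ring

theorem exists_eq_mul_of_nonneg {a b : ℝ} (ha : 0 ≤ a) (hb : 0 ≤ b) :
    ∃ p ∈ Set.Icc (0 : ℝ) 1, a = (a + b) * (1 - p) ∧ b = (a + b) * p := by
  rcases (add_nonneg ha hb).eq_or_lt with h | h
  · exact ⟨0, by simp, by linarith, by linarith⟩
  · refine ⟨b / (a + b), ⟨by positivity, (div_le_one h).2 (by linarith)⟩, ?_, ?_⟩
    · field_simp
      ring
    · field_simp

/-- The perspective of a convex function is subadditive: apply convexity at p and p' with weights
t/(t+t') and t'/(t+t'). -/
theorem channelGap_add_le {ε : ℝ} (h0 : 0 ≤ ε) (h1 : ε ≤ 1) {a b a' b' : ℝ} (ha : 0 ≤ a)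
    (hb : 0 ≤ b) (ha' : 0 ≤ a') (hb' : 0 ≤ b') :
    channelGap ε (a + a') (b + b') ≤ channelGap ε a b + channelGap ε a' b' := by
  obtain ⟨p, hp, e1, e2⟩ := exists_eq_mul_of_nonneg ha hb
  obtain ⟨p', hp', e1', e2'⟩ := exists_eq_mul_of_nonneg ha' hb'
  have ht : 0 ≤ a + b := add_nonneg ha hb
  have ht' : 0 ≤ a' + b' := add_nonneg ha' hb'
  generalize a + b = t at *
  generalize a' + b' = t' at *
  subst e1 e2 e1' e2'
  rcases (add_nonneg ht ht').eq_or_lt with h | h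
  · have : t = 0 := by linarith
    have : t' = 0 := by linarith
    subst t t'
    simp [channelGap]
  · have hc := (convexOn_binEntropy_bsc_sub h0 h1).2 hp hp' (div_nonneg ht h.le)
      (div_nonneg ht' h.le) (by field_simp)
    have e : ∀ q, channelGap ε (t * (1 - p) + t' * (1 - p')) q
        = channelGap ε ((t + t') * (1 - (t / (t + t') * p + t' / (t + t') * p'))) q := by
      intro q
      congr 1
      field_simp
      ring
    have e' : t * p + t' * p' = (t + t') * (t / (t + t') * p + t' / (t + t') * p') := by
      field_simp
    rw [e, e', channelGap_eq, channelGap_eq, channelGap_eq]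
    refine (mul_le_mul_of_nonneg_left hc h.le).trans (le_of_eq ?_)
    simp only [smul_eq_mul]
    field_simp

theorem channelGap_sum_le {ε : ℝ} (h0 : 0 ≤ ε) (h1 : ε ≤ 1) {S : Type*} (T : Finset S)
    {a b : S → ℝ} (ha : ∀ s, 0 ≤ a s) (hb : ∀ s, 0 ≤ b s) :
    channelGap ε (∑ s ∈ T, a s) (∑ s ∈ T, b s) ≤ ∑ s ∈ T, channelGap ε (a s) (b s) := by
  classical
  induction T using Finset.induction_on with
  | empty => simp [channelGap]
  | insert s T hs ih =>
    rw [Finset.sum_insert hs, Finset.sum_insert hs, Finset.sum_insert hs]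
    have := channelGap_add_le h0 h1 (ha s) (hb s)
      (Finset.sum_nonneg fun s _ => ha s : 0 ≤ ∑ s ∈ T, a s)
      (Finset.sum_nonneg fun s _ => hb s : 0 ≤ ∑ s ∈ T, b s)
    linarith

/-! ### Less-noisy comparison for n letters -/

/-- The negative entropy of the distribution proportional to `v`, times the mass of `v`. -/
noncomputable def massNegEntropy {S : Type*} [Fintype S] (v : S → ℝ) : ℝ :=
  negMulLog (∑ s, v s) - ∑ s, negMulLog (v s)

theorem massNegEntropy_mul {S : Type*} [Fintype S] (c : ℝ) (v : S → ℝ) :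
    massNegEntropy (fun s => c * v s) = c * massNegEntropy v := by
  simp only [massNegEntropy, ← Finset.mul_sum, negMulLog_mul, Finset.sum_add_distrib,
    ← Finset.sum_mul]
  ring

/-- The left side minus the right side is `channelGap` of the summed weights minus the sum over s of
the individual gaps, so this is subadditivity. On the erasure side the erased symbol sees the merged
weight and each unerased symbol a single weight. -/
theorem sum_massNegEntropy_bsc_le {ε : ℝ} (h0 : 0 ≤ ε) (h1 : ε ≤ 1) {S : Type*} [Fintype S]
    {H : S → ZMod 2 → ℝ} (hH : ∀ s x, 0 ≤ H s x) :
    ∑ z, massNegEntropy (fun s => ∑ x, H s x * bscSource ε x z) ≤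
      ∑ z, massNegEntropy (fun s => ∑ x, H s x * becSource (4 * ε * (1 - ε)) x z) := by
  have key := channelGap_sum_le h0 h1 Finset.univ (a := fun s => 1 / 2 * H s 0)
    (b := fun s => 1 / 2 * H s 1) (fun s => by have := hH s 0; positivity)
    (fun s => by have := hH s 1; positivity)
  have e0 : (fun s => ∑ x, H s x * bscSource ε x 0)
      = fun s => (1 - ε) * (1 / 2 * H s 0) + ε * (1 / 2 * H s 1) := by
    funext s
    simp [sum_zmod_two, bscSource]
    ring
  have e1 : (fun s => ∑ x, H s x * bscSource ε x 1)
      = fun s => ε * (1 / 2 * H s 0) + (1 - ε) * (1 / 2 * H s 1) := by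
    funext s
    simp [sum_zmod_two, bscSource]
    ring
  have e2 : (fun s => ∑ x, H s x * becSource (4 * ε * (1 - ε)) x none)
      = fun s => 4 * ε * (1 - ε) * (1 / 2 * H s 0 + 1 / 2 * H s 1) := by
    funext s
    simp [sum_zmod_two, becSource]
    ring
  have e3 : (fun s => ∑ x, H s x * becSource (4 * ε * (1 - ε)) x (some 0))
      = fun s => (1 - 2 * ε) ^ 2 * (1 / 2 * H s 0) := by
    funext s
    simp [becSource]
    ring
  have e4 : (fun s => ∑ x, H s x * becSource (4 * ε * (1 - ε)) x (some 1))
      = fun s => (1 - 2 * ε) ^ 2 * (1 / 2 * H s 1) := by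
    funext s
    simp [becSource]
    ring
  rw [Fintype.sum_option, sum_zmod_two, sum_zmod_two, e0, e1, e2, e3, e4,
    massNegEntropy_mul (4 * ε * (1 - ε)), massNegEntropy_mul _ fun s => 1 / 2 * H s 0,
    massNegEntropy_mul _ fun s => 1 / 2 * H s 1]
  simp only [channelGap, Finset.sum_sub_distrib, Finset.sum_add_distrib, ← Finset.mul_sum] at key
  simp only [massNegEntropy, Finset.sum_add_distrib, ← Finset.mul_sum]
  linarith

/-- Total (unnormalized) negative entropy of `S` given the channel output, when the mass of
`(S, Xⁿ)` is given by `F` and the channel acts letter by letter with weights `P`. -/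
noncomputable def outputNegEntropy {Z S : Type} [Fintype Z] [Fintype S] (P : ZMod 2 → Z → ℝ) (n : ℕ)
    (F : S → (Fin n → ZMod 2) → ℝ) : ℝ :=
  ∑ z, massNegEntropy fun s => ∑ x, F s x * iid P n x z

theorem sum_fin_succ {A : Type} [Fintype A] {n : ℕ} (f : (Fin (n + 1) → A) → ℝ) :
    ∑ z, f z = ∑ a, ∑ y, f (Fin.cons a y) := by
  rw [← Fintype.sum_prod_type', ← (Fin.consEquiv fun _ => A).sum_comp]
  rfl

theorem iid_cons {X Z : Type} (P : X → Z → ℝ) (n : ℕ) (a : X) (x : Fin n → X) (c : Z)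
    (z : Fin n → Z) :
    iid P (n + 1) (Fin.cons a x) (Fin.cons c z) = P a c * iid P n x z := by
  simp [iid, Fin.prod_univ_succ]

theorem iid_nonneg {X Z : Type} {P : X → Z → ℝ} (hP : ∀ x z, 0 ≤ P x z) (n : ℕ) (x : Fin n → X)
    (z : Fin n → Z) : 0 ≤ iid P n x z :=
  Finset.prod_nonneg fun _ _ => hP _ _

theorem bscSource_nonneg {ε : ℝ} (h0 : 0 ≤ ε) (h1 : ε ≤ 1) (x z : ZMod 2) :
    0 ≤ bscSource ε x z := by
  unfold bscSource
  split_ifs <;> linarith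

theorem becSource_nonneg {δ : ℝ} (h0 : 0 ≤ δ) (h1 : δ ≤ 1) (x : ZMod 2)
    (z : Option (ZMod 2)) : 0 ≤ becSource δ x z := by
  rcases z with _ | y
  · simp only [becSource]
    linarith
  · simp only [becSource]
    split_ifs <;> linarith

/-- A hybrid argument. With the first output fixed and absorbed into the weights, the induction
hypothesis changes the last n channels; with those outputs absorbed instead, the one-letter
inequality changes the first. Allowing arbitrary nonnegative F is what makes both absorptions
legitimate. -/
theorem outputNegEntropy_bsc_le {ε : ℝ} (h0 : 0 ≤ ε) (h1 : ε ≤ 1) {S : Type} [Fintype S]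
    (n : ℕ) (F : S → (Fin n → ZMod 2) → ℝ) (hF : ∀ s x, 0 ≤ F s x) :
    outputNegEntropy (bscSource ε) n F ≤ outputNegEntropy (becSource (4 * ε * (1 - ε))) n F := by
  induction n with
  | zero => simp [outputNegEntropy, iid]
  | succ n ih =>
    have hbec : ∀ x z, 0 ≤ becSource (4 * ε * (1 - ε)) x z :=
      becSource_nonneg (by nlinarith) (by nlinarith [sq_nonneg (1 - 2 * ε)])
    calc outputNegEntropy (bscSource ε) (n + 1) F
        = ∑ c, outputNegEntropy (bscSource ε) n
            (fun s x => ∑ a, F s (Fin.cons a x) * bscSource ε a c) := by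
          simp only [outputNegEntropy, sum_fin_succ, iid_cons, Finset.sum_mul, mul_assoc]
          refine Finset.sum_congr rfl fun c _ => Finset.sum_congr rfl fun z _ => ?_
          congr 1
          funext s
          exact Finset.sum_comm
      _ ≤ ∑ c, outputNegEntropy (becSource (4 * ε * (1 - ε))) n
            (fun s x => ∑ a, F s (Fin.cons a x) * bscSource ε a c) :=
          Finset.sum_le_sum fun c _ => ih _ fun s x =>
            Finset.sum_nonneg fun a _ => mul_nonneg (hF _ _) (bscSource_nonneg h0 h1 _ _)
      _ = ∑ z, ∑ c, massNegEntropy (fun s => ∑ a,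
            (∑ x, F s (Fin.cons a x) * iid (becSource (4 * ε * (1 - ε))) n x z)
              * bscSource ε a c) := by
          simp only [outputNegEntropy]
          rw [Finset.sum_comm]
          refine Finset.sum_congr rfl fun z _ => Finset.sum_congr rfl fun c _ => ?_
          congr 1
          funext s
          simp only [Finset.sum_mul]
          rw [Finset.sum_comm]
          exact Finset.sum_congr rfl fun _ _ => Finset.sum_congr rfl fun _ _ => by ring
      _ ≤ ∑ z, ∑ c, massNegEntropy (fun s => ∑ a,
            (∑ x, F s (Fin.cons a x) * iid (becSource (4 * ε * (1 - ε))) n x z)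
              * becSource (4 * ε * (1 - ε)) a c) :=
          Finset.sum_le_sum fun z _ => sum_massNegEntropy_bsc_le h0 h1 fun s a =>
            Finset.sum_nonneg fun x _ => mul_nonneg (hF _ _) (iid_nonneg hbec _ _ _)
      _ = outputNegEntropy (becSource (4 * ε * (1 - ε))) (n + 1) F := by
          simp only [outputNegEntropy, sum_fin_succ, iid_cons]
          rw [Finset.sum_comm]
          refine Finset.sum_congr rfl fun z _ => Finset.sum_congr rfl fun c _ => ?_
          congr 1
          funext s
          simp only [Finset.sum_mul]
          exact Finset.sum_congr rfl fun _ _ => Finset.sum_congr rfl fun _ _ => by ring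

/-- This is I(S;Z) = H(S) - H(S|Z). The law of S does not depend on the channel, so only the
conditional term has to be compared. -/
theorem mutualInfo_eq {S Z : Type} [Fintype S] [Fintype Z] {Q : S → Z → ℝ}
    (hQ : ∀ s z, 0 ≤ Q s z) :
    mutualInfo Q = ∑ z, massNegEntropy (fun s => Q s z) + ∑ s, negMulLog (∑ z, Q s z) := by
  have h : ∀ s z, Q s z * log (Q s z / ((∑ z', Q s z') * ∑ s', Q s' z))
      = -negMulLog (Q s z) - Q s z * log (∑ z', Q s z') - Q s z * log (∑ s', Q s' z) := by
    intro s z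
    rcases (hQ s z).eq_or_lt with h | h
    · simp [← h]
    · have h1 : 0 < ∑ z', Q s z' := h.trans_le
        (Finset.single_le_sum (f := fun z' => Q s z') (fun z' _ => hQ s z') (Finset.mem_univ z))
      have h2 : 0 < ∑ s', Q s' z := h.trans_le
        (Finset.single_le_sum (f := fun s' => Q s' z) (fun s' _ => hQ s' z) (Finset.mem_univ s))
      rw [log_div h.ne' (mul_pos h1 h2).ne', log_mul h1.ne' h2.ne', negMulLog]
      ring
  simp only [mutualInfo, h, massNegEntropy, Finset.sum_sub_distrib, ← Finset.sum_mul,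
    Finset.sum_neg_distrib]
  rw [Finset.sum_comm (f := fun s z => negMulLog (Q s z)),
    Finset.sum_comm (f := fun s z => Q s z * log (∑ s', Q s' z))]
  simp only [← Finset.sum_mul, negMulLog, neg_mul, Finset.sum_neg_distrib]
  ring

theorem sum_iid {X Z : Type} [Fintype Z] {P : X → Z → ℝ} {c : ℝ} (hP : ∀ x, ∑ z, P x z = c)
    (n : ℕ) (x : Fin n → X) : ∑ z, iid P n x z = c ^ n := by
  classical
  simp only [iid]
  rw [← Fintype.piFinset_univ, ← Finset.prod_univ_sum]
  simp [hP]

theorem sum_bscSource (ε : ℝ) (x : ZMod 2) : ∑ z, bscSource ε x z = 1 / 2 := by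
  rcases zmod_two_eq x with rfl | rfl <;> simp [sum_zmod_two, bscSource] <;> ring

theorem sum_becSource (δ : ℝ) (x : ZMod 2) : ∑ z, becSource δ x z = 1 / 2 := by
  rcases zmod_two_eq x with rfl | rfl <;> simp [Fintype.sum_option, becSource] <;> ring

theorem sum_keyJoint_iid {X Z S : Type} [Fintype X] [Fintype Z] [DecidableEq S]
    {P : X → Z → ℝ} {c : ℝ} (hP : ∀ x, ∑ z, P x z = c) (n : ℕ) (f : (Fin n → X) → S) (s : S) :
    ∑ z, keyJoint (iid P n) f s z = (Finset.univ.filter fun x => f x = s).card * c ^ n := by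
  simp only [keyJoint]
  rw [Finset.sum_comm]
  simp [sum_iid hP]

theorem keyJoint_nonneg {X Z S : Type} [Fintype X] [DecidableEq S] {P : X → Z → ℝ}
    (hP : ∀ x z, 0 ≤ P x z) (f : X → S) (s : S) (z : Z) : 0 ≤ keyJoint P f s z :=
  Finset.sum_nonneg fun _ _ => hP _ _

/-- The erasure channel is less noisy than the symmetric channel. -/
theorem mutualInfo_bsc_le_bec {ε : ℝ} (h0 : 0 ≤ ε) (h1 : ε ≤ 1) {S : Type} [Fintype S]
    [DecidableEq S] (n : ℕ) (f : (Fin n → ZMod 2) → S) :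
    mutualInfo (keyJoint (iid (bscSource ε) n) f) ≤
      mutualInfo (keyJoint (iid (becSource (4 * ε * (1 - ε))) n) f) := by
  have hbec : ∀ x z, 0 ≤ becSource (4 * ε * (1 - ε)) x z :=
    becSource_nonneg (by nlinarith) (by nlinarith [sq_nonneg (1 - 2 * ε)])
  rw [mutualInfo_eq (keyJoint_nonneg (iid_nonneg (bscSource_nonneg h0 h1) n) f),
    mutualInfo_eq (keyJoint_nonneg (iid_nonneg hbec n) f)]
  simp only [sum_keyJoint_iid (sum_bscSource ε), sum_keyJoint_iid (sum_becSource _)]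
  have := outputNegEntropy_bsc_le h0 h1 n (fun s x => if f x = s then 1 else 0)
    (fun s x => by split_ifs <;> norm_num)
  simp only [outputNegEntropy, ite_mul, one_mul, zero_mul, ← Finset.sum_filter] at this
  exact add_le_add_left this _

theorem leakageExponent_bec_le_bsc {ε : ℝ} (h0 : 0 ≤ ε) (h1 : ε ≤ 1) (F : HashSequence) :
    F.leakageExponent (becSource (4 * ε * (1 - ε))) ≤ F.leakageExponent (bscSource ε) := by
  refine liminf_le_liminf (Eventually.of_forall fun n => ?_)
  refine EReal.div_le_div_right_of_nonneg (by positivity) (EReal.neg_le_neg_iff.2 ?_)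
  exact ENNReal.log_le_log (ENNReal.ofReal_le_ofReal (mutualInfo_bsc_le_bec h0 h1 n _))

theorem optimalExponent_bec_le_bsc {ε : ℝ} (h0 : 0 ≤ ε) (h1 : ε ≤ 1) (C : Set HashSequence)
    (R : ℝ) :
    optimalExponent C (becSource (4 * ε * (1 - ε))) R ≤ optimalExponent C (bscSource ε) R := by
  refine sSup_le ?_
  rintro _ ⟨F, hF, hR, rfl⟩
  exact (leakageExponent_bec_le_bsc h0 h1 F).trans (le_sSup ⟨F, hF, hR, rfl⟩)

/-! ### Fourier analysis of linear hashes over the erasure channel -/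

/-- The nontrivial real character of `𝔽₂`. -/
def binaryChar (x : ZMod 2) : ℝ := if x = 0 then 1 else -1

theorem binaryChar_add (x y : ZMod 2) : binaryChar (x + y) = binaryChar x * binaryChar y := by
  rcases zmod_two_eq x with rfl | rfl <;> rcases zmod_two_eq y with rfl | rfl <;>
    simp [binaryChar, show (1 : ZMod 2) + 1 = 0 from rfl]

theorem binaryChar_sum {ι : Type*} (T : Finset ι) (f : ι → ZMod 2) :
    binaryChar (∑ i ∈ T, f i) = ∏ i ∈ T, binaryChar (f i) := by
  classical
  induction T using Finset.induction_on with
  | empty => simp [binaryChar]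
  | insert i T hi ih => rw [Finset.sum_insert hi, Finset.prod_insert hi, binaryChar_add, ih]

theorem sum_prod_pi {A : Type*} [Fintype A] {n : ℕ} (f : Fin n → A → ℝ) :
    ∑ z : Fin n → A, ∏ i, f i (z i) = ∏ i, ∑ a, f i a := by
  classical
  rw [Finset.prod_univ_sum, Fintype.piFinset_univ]

open Matrix in
theorem sum_binaryChar_dotProduct {k : ℕ} (t : Fin k → ZMod 2) :
    ∑ u : Fin k → ZMod 2, binaryChar (u ⬝ᵥ t) = if t = 0 then 2 ^ k else 0 := by
  have h : ∀ a : ZMod 2, binaryChar 0 + binaryChar a = if a = 0 then 2 else 0 := by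
    intro a
    rcases zmod_two_eq a with rfl | rfl <;> norm_num [binaryChar]
  simp only [dotProduct, binaryChar_sum]
  rw [sum_prod_pi fun i a => binaryChar (a * t i)]
  simp only [sum_zmod_two, zero_mul, one_mul, h]
  split_ifs with ht
  · simp [ht]
  · obtain ⟨i, hi⟩ := Function.ne_iff.1 ht
    exact Finset.prod_eq_zero (Finset.mem_univ i) (if_neg hi)

open Matrix in
theorem parseval_binaryChar {k : ℕ} (q : (Fin k → ZMod 2) → ℝ) :
    ∑ u : Fin k → ZMod 2, (∑ s, q s * binaryChar (u ⬝ᵥ s)) ^ 2 = 2 ^ k * ∑ s, q s ^ 2 := by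
  have h : ∀ s t : Fin k → ZMod 2, s + t = 0 ↔ s = t := fun s t => by
    rw [add_eq_zero_iff_eq_neg, ZModModule.neg_eq_self]
  calc ∑ u : Fin k → ZMod 2, (∑ s, q s * binaryChar (u ⬝ᵥ s)) ^ 2
      = ∑ u : Fin k → ZMod 2, ∑ s, ∑ t, q s * q t * binaryChar (u ⬝ᵥ (s + t)) := by
        refine Finset.sum_congr rfl fun u _ => ?_
        rw [sq, Finset.sum_mul_sum]
        refine Finset.sum_congr rfl fun s _ => Finset.sum_congr rfl fun t _ => ?_
        rw [dotProduct_add, binaryChar_add]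
        ring
    _ = ∑ s, ∑ t, ∑ u : Fin k → ZMod 2, q s * q t * binaryChar (u ⬝ᵥ (s + t)) := by
        rw [Finset.sum_comm]
        exact Finset.sum_congr rfl fun s _ => Finset.sum_comm
    _ = 2 ^ k * ∑ s, q s ^ 2 := by
        simp only [← Finset.mul_sum, sum_binaryChar_dotProduct, h]
        simp only [mul_ite, mul_zero, Finset.sum_ite_eq, Finset.mem_univ, if_true,
          ← Finset.sum_mul, sq]
        ring

/-- The χ² bound, from log t ≤ t - 1. Being quadratic in Q, it is open to Parseval. -/
theorem mutualInfo_le_sum_sq_div {S Z : Type} [Fintype S] [Fintype Z] {Q : S → Z → ℝ}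
    (hQ : ∀ s z, 0 ≤ Q s z) :
    mutualInfo Q ≤
      ∑ s, ∑ z, Q s z ^ 2 / ((∑ z', Q s z') * ∑ s', Q s' z) - ∑ s, ∑ z, Q s z := by
  rw [← Finset.sum_sub_distrib, mutualInfo]
  refine Finset.sum_le_sum fun s _ => ?_
  rw [← Finset.sum_sub_distrib]
  refine Finset.sum_le_sum fun z _ => ?_
  rcases (hQ s z).eq_or_lt with h | h
  · simp [← h]
  · have h1 : 0 < ∑ z', Q s z' := h.trans_le
      (Finset.single_le_sum (f := fun z' => Q s z') (fun z' _ => hQ s z') (Finset.mem_univ z))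
    have h2 : 0 < ∑ s', Q s' z := h.trans_le
      (Finset.single_le_sum (f := fun s' => Q s' z) (fun s' _ => hQ s' z) (Finset.mem_univ s))
    have := mul_le_mul_of_nonneg_left
      (log_le_sub_one_of_pos (div_pos h (mul_pos h1 h2))) h.le
    refine this.trans (le_of_eq ?_)
    ring

theorem mutualInfo_keyJoint_equiv {X Z S T : Type} [Fintype X] [Fintype Z] [Fintype S]
    [Fintype T] [DecidableEq S] [DecidableEq T] (P : X → Z → ℝ) (g : X → S) (e : S ≃ T) :
    mutualInfo (keyJoint P fun x => e (g x)) = mutualInfo (keyJoint P g) := by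
  have h : ∀ s z, keyJoint P (fun x => e (g x)) (e s) z = keyJoint P g s z := by
    intro s z
    simp [keyJoint]
  simp only [mutualInfo, ← e.sum_comp, h]

theorem card_fiber_of_surjective {V W : Type*} [AddCommGroup V] [AddCommGroup W] [Fintype V]
    [Fintype W] [DecidableEq W] {f : V →+ W} (hf : Function.Surjective f) (w : W) :
    (Finset.univ.filter fun v => f v = w).card * Fintype.card W = Fintype.card V := by
  have h : ∀ w', (Finset.univ.filter fun v => f v = w').card
      = (Finset.univ.filter fun v => f v = w).card := fun w' =>
    AddMonoidHom.card_fiber_eq_of_mem_range f (hf w') (hf w)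
  have := Finset.card_eq_sum_card_fiberwise (f := f) (s := Finset.univ) (t := Finset.univ)
    (fun _ _ => Finset.mem_univ _)
  rw [← Finset.card_univ (α := V), this, Finset.sum_congr rfl fun w' _ => h w', Finset.sum_const,
    Finset.card_univ, smul_eq_mul, mul_comm]

theorem mulVec_surjective_of_rank_eq {k n : ℕ} {M : Matrix (Fin k) (Fin n) (ZMod 2)}
    (hM : M.rank = k) : Function.Surjective M.mulVec := by
  have : M.mulVecLin.range = ⊤ := by
    refine Submodule.eq_top_of_finrank_eq ?_
    rw [Module.finrank_fin_fun]
    exact hM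
  exact LinearMap.range_eq_top.1 this

theorem card_mulVec_fiber {k n : ℕ} {M : Matrix (Fin k) (Fin n) (ZMod 2)} (hM : M.rank = k)
    (s : Fin k → ZMod 2) :
    ((Finset.univ.filter fun x => M.mulVec x = s).card : ℝ) * 2 ^ k = 2 ^ n := by
  have := card_fiber_of_surjective (f := M.mulVecLin.toAddMonoidHom)
    (mulVec_surjective_of_rank_eq hM) s
  simp only [Fintype.card_pi, ZMod.card, Finset.prod_const, Finset.card_univ,
    Fintype.card_fin] at this
  exact_mod_cast this

theorem linear_subset_uniformKey : HashSequence.linear ⊆ HashSequence.uniformKey := by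
  intro F hF n s
  obtain ⟨k, M, e, hM, hf⟩ := hF n
  have hsize : (F.size n : ℝ) = 2 ^ k := by
    have := Fintype.card_congr e
    simp only [Fintype.card_pi, ZMod.card, Finset.prod_const, Finset.card_univ,
      Fintype.card_fin] at this
    rw [← this]
    norm_num
  have := card_mulVec_fiber hM (e.symm s)
  have hfil : (Finset.univ.filter fun x => F.hash n x = s)
      = Finset.univ.filter fun x => M.mulVec x = e.symm s := by
    ext x
    simp [hf, Matrix.vecMul_transpose, Equiv.eq_symm_apply]
  rw [hfil, hsize, ← this]
  have h0 : ((Finset.univ.filter fun x => M.mulVec x = e.symm s).card : ℝ) ≠ 0 := by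
    intro h
    rw [h, zero_mul] at this
    exact absurd this.symm (by positivity)
  field_simp

/-- The probability that no coordinate of the support of `v` is erased, if each coordinate is
kept with probability `a`. -/
def keepWeight (a : ℝ) {n : ℕ} (v : Fin n → ZMod 2) : ℝ := ∏ i, if v i = 0 then 1 else a

/-- For v = 1 the erased symbol contributes 0, since its two character values cancel, and each
unerased symbol contributes (1-δ)/2. For v = 0 the sum is the total mass. -/
theorem sum_sq_div_becSource (δ : ℝ) (v : ZMod 2) :
    ∑ z, (∑ x, becSource δ x z * binaryChar (v * x)) ^ 2 / ∑ x, becSource δ x z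
      = if v = 0 then 1 else 1 - δ := by
  have h : ∀ t : ℝ, t ^ 2 / t = t := fun t => by
    rcases eq_or_ne t 0 with rfl | ht
    · simp
    · field_simp
  rcases zmod_two_eq v with rfl | rfl
  · simp [Fintype.sum_option, becSource, binaryChar, h]
    ring
  · simp [Fintype.sum_option, sum_zmod_two, becSource, binaryChar, h]

theorem sum_iid_becSource_sq_div (δ : ℝ) {n : ℕ} (v : Fin n → ZMod 2) :
    ∑ z, (∑ x, iid (becSource δ) n x z * binaryChar (dotProduct v x)) ^ 2
      / ∑ x, iid (becSource δ) n x z = keepWeight (1 - δ) v := by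
  have h1 : ∀ z, ∑ x, iid (becSource δ) n x z * binaryChar (dotProduct v x)
      = ∏ i, ∑ a, becSource δ a (z i) * binaryChar (v i * a) := by
    intro z
    rw [← sum_prod_pi fun i a => becSource δ a (z i) * binaryChar (v i * a)]
    refine Finset.sum_congr rfl fun x _ => ?_
    rw [iid, dotProduct, binaryChar_sum, Finset.prod_mul_distrib]
  have h2 : ∀ z, ∑ x, iid (becSource δ) n x z = ∏ i, ∑ a, becSource δ a (z i) := fun z =>
    sum_prod_pi fun i a => becSource δ a (z i)
  simp only [h1, h2, ← Finset.prod_pow, ← Finset.prod_div_distrib]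
  rw [sum_prod_pi fun i c => (∑ a, becSource δ a c * binaryChar (v i * a)) ^ 2
    / ∑ a, becSource δ a c]
  simp only [sum_sq_div_becSource, keepWeight]

/-- The information that the output of the erasure channel gives about a linear hash is at most
the expected number of nonzero words of the code spanned by the rows of `M` whose support is not
hit by the erasures. -/
theorem mutualInfo_linear_bec_le {δ : ℝ} (h0 : 0 ≤ δ) (h1 : δ ≤ 1) {k n : ℕ}
    {M : Matrix (Fin k) (Fin n) (ZMod 2)} (hM : M.rank = k) :
    mutualInfo (keyJoint (iid (becSource δ) n) M.mulVec) ≤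
      ∑ u with u ≠ 0, keepWeight (1 - δ) (Matrix.vecMul u M) := by
  have hQ := keyJoint_nonneg (iid_nonneg (becSource_nonneg h0 h1) n) M.mulVec
  have hS : ∀ s, ∑ z, keyJoint (iid (becSource δ) n) M.mulVec s z = (2 ^ k)⁻¹ := by
    intro s
    rw [sum_keyJoint_iid (sum_becSource δ), one_div, inv_pow]
    have h2 : (2 : ℝ) ^ n ≠ 0 := by positivity
    have h3 : (2 : ℝ) ^ k ≠ 0 := by positivity
    rw [← div_eq_mul_inv, div_eq_iff h2, ← card_mulVec_fiber hM s]
    field_simp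
  have hZ : ∀ z, ∑ s, keyJoint (iid (becSource δ) n) M.mulVec s z
      = ∑ x, iid (becSource δ) n x z := fun z => Finset.sum_fiberwise _ _ _
  -- The character u of the hash Mx is the character uM of x, so the Fourier coefficients run over
  -- the row space of M.
  have hchar : ∀ (u : Fin k → ZMod 2) z,
      ∑ s, keyJoint (iid (becSource δ) n) M.mulVec s z * binaryChar (dotProduct u s)
        = ∑ x, iid (becSource δ) n x z * binaryChar (dotProduct (Matrix.vecMul u M) x) := by
    intro u z
    rw [← Finset.sum_fiberwise _ M.mulVec]
    refine Finset.sum_congr rfl fun s _ => ?_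
    rw [keyJoint, Finset.sum_mul]
    refine Finset.sum_congr rfl fun x hx => ?_
    rw [← (Finset.mem_filter.1 hx).2, Matrix.dotProduct_mulVec]
  refine (mutualInfo_le_sum_sq_div hQ).trans (le_of_eq ?_)
  simp only [hS, hZ]
  have hsum : ∑ u : Fin k → ZMod 2, keepWeight (1 - δ) (Matrix.vecMul u M)
      = ∑ s, ∑ z, keyJoint (iid (becSource δ) n) M.mulVec s z ^ 2
        / ((2 ^ k)⁻¹ * ∑ x, iid (becSource δ) n x z) := by
    rw [Finset.sum_comm]
    simp only [← sum_iid_becSource_sq_div]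
    rw [Finset.sum_comm]
    refine Finset.sum_congr rfl fun z _ => ?_
    simp only [← hchar]
    rw [← Finset.sum_div, parseval_binaryChar, ← Finset.sum_div]
    field_simp
  -- The word u = 0 contributes 1, which cancels the total mass subtracted in the χ² bound.
  rw [← hsum, ← Finset.sum_filter_add_sum_filter_not Finset.univ fun u : Fin k → ZMod 2 => u ≠ 0]
  simp [Finset.filter_eq', keepWeight]

/-! ### Existence of good codes and the expurgation bound -/

/-- Averaging over the dilates of a fixed code by the nonzero elements of `𝔽_{2ⁿ}`. -/
theorem exists_matrix_rank_eq_sum_le {k n : ℕ} (hkn : k ≤ n) {w : (Fin n → ZMod 2) → ℝ}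
    (hw : ∀ v, 0 ≤ w v) :
    ∃ M : Matrix (Fin k) (Fin n) (ZMod 2), M.rank = k ∧
      ∑ u with u ≠ 0, w (Matrix.vecMul u M) ≤ 2 ^ k / 2 ^ n * ∑ v, w v := by
  classical
  suffices h : ∃ φ : (Fin k → ZMod 2) →ₗ[ZMod 2] (Fin n → ZMod 2), Function.Injective φ ∧
      ∑ u with u ≠ 0, w (φ u) ≤ 2 ^ k / 2 ^ n * ∑ v, w v by
    obtain ⟨φ, hφ, hle⟩ := h
    refine ⟨(LinearMap.toMatrix' φ).transpose, ?_, ?_⟩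
    · rw [Matrix.rank_transpose, Matrix.rank, ← Matrix.toLin'_apply', Matrix.toLin'_toMatrix',
        LinearMap.finrank_range_of_inj hφ, Module.finrank_fin_fun]
    · simpa [Matrix.vecMul_transpose, LinearMap.toMatrix'_mulVec] using hle
  -- The case n = 0 is separate: no field has dimension 0 over 𝔽₂.
  rcases Nat.eq_zero_or_pos n with rfl | hn
  · obtain rfl : k = 0 := by omega
    refine ⟨LinearMap.id, fun _ _ h => h, ?_⟩
    rw [Finset.sum_eq_zero fun u hu => absurd (Subsingleton.elim u 0) (Finset.mem_filter.1 hu).2]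
    exact mul_nonneg (by positivity) (Finset.sum_nonneg fun v _ => hw v)
  · have : Fintype (GaloisField 2 n) := Fintype.ofFinite _
    obtain ⟨E⟩ : Nonempty ((Fin n → ZMod 2) ≃ₗ[ZMod 2] GaloisField 2 n) :=
      ⟨LinearEquiv.ofFinrankEq _ _ (by rw [Module.finrank_fin_fun, GaloisField.finrank 2 hn.ne'])⟩
    let ι := Function.ExtendByZero.linearMap (ZMod 2) (Fin.castLE hkn)
    have hι : Function.Injective ι := fun u v huv => funext fun i => by
      have := congrFun huv (Fin.castLE hkn i)
      simpa [ι, (Fin.castLE_injective hkn).extend_apply] using this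
    let φ : GaloisField 2 n → (Fin k → ZMod 2) →ₗ[ZMod 2] (Fin n → ZMod 2) := fun g =>
      E.symm.toLinearMap ∘ₗ LinearMap.mulLeft (ZMod 2) g ∘ₗ E.toLinearMap ∘ₗ ι
    have hφ : ∀ g u, φ g u = E.symm (g * E (ι u)) := fun _ _ => rfl
    have hinj : ∀ g, g ≠ 0 → Function.Injective (φ g) := fun g hg u v huv => by
      rw [hφ, hφ] at huv
      exact hι (E.injective (mul_left_cancel₀ hg (E.symm.injective huv)))
    have hcard : (Finset.univ.filter fun g : GaloisField 2 n => g ≠ 0).card = 2 ^ n - 1 := by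
      rw [Finset.filter_ne', Finset.card_erase_of_mem (Finset.mem_univ _), Finset.card_univ,
        ← Fintype.card_congr E.toEquiv]
      simp
    have hcard' : (Finset.univ.filter fun u : Fin k → ZMod 2 => u ≠ 0).card = 2 ^ k - 1 := by
      rw [Finset.filter_ne', Finset.card_erase_of_mem (Finset.mem_univ _), Finset.card_univ]
      simp
    have h1n : (1 : ℕ) ≤ 2 ^ n := Nat.one_le_two_pow
    have h1k : (1 : ℕ) ≤ 2 ^ k := Nat.one_le_two_pow
    have hpos : (1 : ℝ) < 2 ^ n := one_lt_pow₀ (by norm_num) hn.ne'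
    have hposk : (1 : ℝ) ≤ 2 ^ k := one_le_pow₀ (by norm_num)
    have hW : 0 ≤ ∑ v, w v := Finset.sum_nonneg fun v _ => hw v
    -- For fixed u ≠ 0, the product of g with the image of u takes each field element once as g
    -- varies.
    have horbit : ∀ u : Fin k → ZMod 2, u ≠ 0 →
        ∑ g with g ≠ 0, w (φ g u) ≤ ∑ v, w v := by
      intro u hu
      have hEu : E (ι u) ≠ 0 := by
        simpa using (map_ne_zero_iff ι hι).2 hu
      rw [← E.symm.toEquiv.sum_comp w]
      calc ∑ g with g ≠ 0, w (φ g u) ≤ ∑ g, w (φ g u) :=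
            Finset.sum_le_sum_of_subset_of_nonneg (Finset.filter_subset _ _) fun _ _ _ => hw _
        _ = ∑ g, w (E.symm g) := Equiv.sum_comp (Equiv.mulRight₀ _ hEu) fun g => w (E.symm g)
    have hne : (Finset.univ.filter fun g : GaloisField 2 n => g ≠ 0).Nonempty :=
      ⟨1, by simp⟩
    -- Some g does no worse than the average, whose factor is (2^k - 1)/(2^n - 1) ≤ 2^k/2^n because
    -- k ≤ n.
    obtain ⟨g, hg, hle⟩ := Finset.exists_le_of_sum_le hne
      (f := fun g => ∑ u with u ≠ 0, w (φ g u)) (g := fun _ => 2 ^ k / 2 ^ n * ∑ v, w v) (by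
        rw [Finset.sum_comm, Finset.sum_const, hcard, nsmul_eq_mul]
        refine (Finset.sum_le_sum fun u hu => horbit u (Finset.mem_filter.1 hu).2).trans ?_
        rw [Finset.sum_const, hcard', nsmul_eq_mul, ← mul_assoc]
        refine mul_le_mul_of_nonneg_right ?_ hW
        push_cast [Nat.cast_sub h1n, Nat.cast_sub h1k]
        rw [mul_div_assoc', le_div_iff₀ (by positivity)]
        have : (2 : ℝ) ^ k ≤ 2 ^ n := pow_le_pow_right₀ (by norm_num) hkn
        nlinarith)
    exact ⟨φ g, hinj g (Finset.mem_filter.1 hg).2, hle⟩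

theorem keepWeight_nonneg {a : ℝ} (ha : 0 ≤ a) {n : ℕ} (v : Fin n → ZMod 2) :
    0 ≤ keepWeight a v :=
  Finset.prod_nonneg fun _ _ => by split_ifs <;> simp [ha]

theorem keepWeight_rpow {a : ℝ} (ha : 0 ≤ a) (t : ℝ) {n : ℕ} (v : Fin n → ZMod 2) :
    keepWeight (a ^ t) v = keepWeight a v ^ t := by
  rw [keepWeight, keepWeight, ← finsetProd_rpow _ _ (fun _ _ => by split_ifs <;> simp [ha])]
  refine Finset.prod_congr rfl fun i _ => ?_
  split_ifs <;> simp

theorem sum_keepWeight (a : ℝ) (n : ℕ) : ∑ v : Fin n → ZMod 2, keepWeight a v = (1 + a) ^ n := by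
  simp only [keepWeight]
  rw [sum_prod_pi fun _ v => if v = 0 then 1 else a]
  simp [sum_zmod_two]

/-- The ℓ^θ norm is at most the ℓ¹ norm: every y i is at most B, so y^θ = y · y^(θ-1) ≤ y · B^(θ-1).
-/
theorem sum_rpow_le_rpow {ι : Type*} {T : Finset ι} {y : ι → ℝ} (hy : ∀ i ∈ T, 0 ≤ y i) {B θ : ℝ}
    (hB : 0 < B) (hθ : 1 ≤ θ) (h : ∑ i ∈ T, y i ≤ B) : ∑ i ∈ T, y i ^ θ ≤ B ^ θ := by
  have hsplit : ∀ x : ℝ, 0 ≤ x → x ^ θ = x * x ^ (θ - 1) := fun x hx => by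
    rcases hx.eq_or_lt with rfl | hx
    · rw [zero_rpow (by linarith), zero_mul]
    · rw [rpow_sub_one hx.ne']
      field_simp
  calc ∑ i ∈ T, y i ^ θ ≤ ∑ i ∈ T, y i * B ^ (θ - 1) := by
        refine Finset.sum_le_sum fun i hi => ?_
        rw [hsplit _ (hy i hi)]
        refine mul_le_mul_of_nonneg_left (rpow_le_rpow (hy i hi) ?_ (by linarith)) (hy i hi)
        exact (Finset.single_le_sum hy hi).trans h
    _ ≤ B ^ θ := by
        rw [← Finset.sum_mul, hsplit B hB.le]
        exact mul_le_mul_of_nonneg_right h (rpow_nonneg hB.le _)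

/-- The expurgation step: the code is chosen to be good for the θ-th roots of the weights, and the
bound on their sum is then raised to the power θ. For θ > 1 this can beat averaging the weights
themselves. -/
theorem exists_linear_mutualInfo_bec_le {δ θ : ℝ} (h0 : 0 ≤ δ) (h1 : δ ≤ 1) (hθ : 1 ≤ θ) {k n : ℕ}
    (hkn : k ≤ n) :
    ∃ M : Matrix (Fin k) (Fin n) (ZMod 2), M.rank = k ∧
      mutualInfo (keyJoint (iid (becSource δ) n) M.mulVec) ≤
        (2 ^ k / 2 ^ n * (1 + (1 - δ) ^ (1 / θ)) ^ n) ^ θ := by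
  have ha : 0 ≤ 1 - δ := sub_nonneg.2 h1
  have hb : 0 ≤ (1 - δ) ^ (1 / θ) := rpow_nonneg ha _
  obtain ⟨M, hM, hle⟩ := exists_matrix_rank_eq_sum_le hkn
    (w := keepWeight ((1 - δ) ^ (1 / θ))) (keepWeight_nonneg hb)
  refine ⟨M, hM, (mutualInfo_linear_bec_le h0 h1 hM).trans ?_⟩
  rw [sum_keepWeight] at hle
  have := sum_rpow_le_rpow (fun u _ => keepWeight_nonneg hb (Matrix.vecMul u M)) (by positivity)
    hθ hle
  refine le_trans (le_of_eq (Finset.sum_congr rfl fun u _ => ?_)) this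
  rw [← keepWeight_rpow hb, ← rpow_mul ha, one_div_mul_cancel (by linarith), rpow_one]

theorem expurgationObjective_le_optimalExponent_linear {δ R θ : ℝ} (h0 : 0 ≤ δ) (h1 : δ ≤ 1)
    (hR0 : 0 ≤ R) (hR1 : R ≤ log 2) (hθ : 1 ≤ θ) :
    (expurgationObjective R (1 - δ) θ : EReal) ≤
      optimalExponent HashSequence.linear (becSource δ) R := by
  have hlog : 0 < log 2 := log_pos (by norm_num)
  have hc : 0 ≤ R / log 2 := by positivity
  -- Rounding up keeps (k/n) log 2 ≥ R for every n > 0, while k/n → R / log 2 leaves the exponent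
  -- unchanged; R ≤ log 2 ensures k ≤ n.
  let k : ℕ → ℕ := fun n => ⌈R / log 2 * n⌉₊
  have hk : ∀ n, k n ≤ n := fun n => Nat.ceil_le.2
    (mul_le_of_le_one_left (Nat.cast_nonneg n) ((div_le_one hlog).2 hR1))
  choose M hM hle using fun n => exists_linear_mutualInfo_bec_le h0 h1 hθ (hk n)
  have e : ∀ n, (Fin (k n) → ZMod 2) ≃ Fin (2 ^ k n) := fun n =>
    Fintype.equivFinOfCardEq (by simp)
  let F : HashSequence := ⟨fun n => 2 ^ k n, fun n x => e n ((M n).mulVec x)⟩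
  have hFlin : F ∈ HashSequence.linear := fun n =>
    ⟨k n, M n, e n, hM n, fun x => by rw [Matrix.vecMul_transpose]⟩
  have hrate : (R : EReal) ≤ F.rate := by
    refine le_liminf_of_le (by isBoundedDefault) ((eventually_gt_atTop 0).mono fun n hn => ?_)
    have hn' : (0 : ℝ) < n := Nat.cast_pos.2 hn
    rw [EReal.coe_le_coe_iff, le_div_iff₀ hn']
    have : R / log 2 * n ≤ k n := Nat.le_ceil _
    change R * n ≤ log ((2 ^ k n : ℕ) : ℝ)
    rw [Nat.cast_pow, log_pow, Nat.cast_ofNat]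
    calc R * n = R / log 2 * n * log 2 := by field_simp
      _ ≤ k n * log 2 := mul_le_mul_of_nonneg_right this hlog.le
  refine le_trans ?_ (le_sSup ⟨F, hFlin, hrate, rfl⟩)
  have hb : 0 < 1 + (1 - δ) ^ (1 / θ) := by
    have := rpow_nonneg (sub_nonneg.2 h1) (1 / θ)
    linarith
  have hlim : Tendsto (fun n : ℕ =>
      θ * (log 2 - (k n : ℝ) / n * log 2 - log (1 + (1 - δ) ^ (1 / θ)))) atTop
      (nhds (expurgationObjective R (1 - δ) θ)) := by
    have hkn : Tendsto (fun n : ℕ => (k n : ℝ) / n) atTop (nhds (R / log 2)) :=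
      (tendsto_nat_ceil_mul_div_atTop hc).comp tendsto_natCast_atTop_atTop
    have := (((hkn.mul_const (log 2)).const_sub (log 2)).sub_const
      (log (1 + (1 - δ) ^ (1 / θ)))).const_mul θ
    rwa [div_mul_cancel₀ _ hlog.ne'] at this
  rw [← ((continuous_coe_real_ereal.tendsto _).comp hlim).liminf_eq]
  refine liminf_le_liminf ((eventually_gt_atTop 0).mono fun n hn => ?_)
  have hn' : (n : ℝ) ≠ 0 := Nat.cast_ne_zero.2 hn.ne'
  set B : ℝ := 2 ^ k n / 2 ^ n * (1 + (1 - δ) ^ (1 / θ)) ^ n with hBdef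
  have hB : 0 < B := by positivity
  have hI : F.leakedInfo (becSource δ) n ≤ B ^ θ := by
    have h := mutualInfo_keyJoint_equiv (iid (becSource δ) n) (M n).mulVec (e n)
    exact h.trans_le (hle n)
  calc ((θ * (log 2 - (k n : ℝ) / n * log 2 - log (1 + (1 - δ) ^ (1 / θ))) : ℝ) : EReal)
      = -ENNReal.log (ENNReal.ofReal (B ^ θ)) / (n : EReal) := by
        rw [ENNReal.log_ofReal_of_pos (rpow_pos_of_pos hB θ), log_rpow hB, hBdef,
          log_mul (by positivity) (by positivity), log_div (by positivity) (by positivity),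
          log_pow, log_pow, log_pow, ← EReal.coe_neg, ← EReal.coe_natCast, ← EReal.coe_div]
        congr 1
        field_simp
        ring
    _ ≤ _ := EReal.div_le_div_right_of_nonneg (by positivity) (EReal.neg_le_neg_iff.2
        (ENNReal.log_le_log (ENNReal.ofReal_le_ofReal hI)))

theorem optimalExponent_mono {Z : Type} [Fintype Z] {C D : Set HashSequence} (h : C ⊆ D)
    (P : ZMod 2 → Z → ℝ) (R : ℝ) : optimalExponent C P R ≤ optimalExponent D P R :=
  sSup_le_sSup fun _ ⟨F, hF, hR⟩ => ⟨F, h hF, hR⟩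

theorem expurgationExponent_le_optimalExponent {δ R : ℝ} (h0 : 0 ≤ δ) (h1 : δ ≤ 1)
    (hR0 : 0 ≤ R) (hR1 : R ≤ log 2) {C : Set HashSequence} (hC : HashSequence.linear ⊆ C) :
    expurgationExponent R (1 - δ) ≤ optimalExponent C (becSource δ) R :=
  iSup₂_le fun _ hθ => (expurgationObjective_le_optimalExponent_linear h0 h1 hR0 hR1 hθ).trans
    (optimalExponent_mono hC _ _)

/-! ### Quadratic lower bound for the binary entropy -/

theorem hasDerivAt_binEntropy_sub_quadratic {c x : ℝ} (hx : x ∈ Set.Ioo (0 : ℝ) 1) :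
    HasDerivAt (fun x => binEntropy x - c * (x * (1 - x)))
      (log (1 - x) - log x - c * (1 - 2 * x)) x := by
  have hq := (hasDerivAt_id x).mul ((hasDerivAt_id x).const_sub 1)
  have := (hasDerivAt_binEntropy hx.1.ne' hx.2.ne).sub (hq.const_mul c)
  refine this.congr_deriv ?_
  simp only [id]
  ring

theorem hasDerivAt_log_sub_linear {c x : ℝ} (hx : x ∈ Set.Ioo (0 : ℝ) 1) :
    HasDerivAt (fun x => log (1 - x) - log x - c * (1 - 2 * x))
      (2 * c - 1 / (x * (1 - x))) x := by
  have hx0 : x ≠ 0 := hx.1.ne'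
  have hx1 : 1 - x ≠ 0 := (sub_pos.2 hx.2).ne'
  have := (((hasDerivAt_id x).const_sub 1).log hx1).sub ((hasDerivAt_id x).log hx0) |>.sub
    ((((hasDerivAt_id x).const_mul 2).const_sub 1).const_mul c)
  refine this.congr_deriv ?_
  simp only [id]
  field_simp
  ring

/-- The quadratic lower bound on the binary entropy function. -/
theorem log_two_mul_le_binEntropy {x : ℝ} (h0 : 0 ≤ x) (h1 : x ≤ 1) :
    4 * log 2 * (x * (1 - x)) ≤ binEntropy x := by
  wlog hx : x ≤ 1 / 2 generalizing x
  · have := this (x := 1 - x) (by linarith) (by linarith) (by linarith)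
    rw [binEntropy_one_sub] at this
    linarith
  have hlog : 0.6931471803 < log 2 := log_two_gt_d9
  let d : ℝ → ℝ := fun x => binEntropy x - 4 * log 2 * (x * (1 - x))
  have hcont : Continuous d := by fun_prop
  suffices 0 ≤ d x from sub_nonneg.1 this
  have hhalf : d (1 / 2) = 0 := by
    have := binEntropy_two_inv
    simp only [d, one_div, this]
    ring
  -- y is an inflection point of d, where d'' = 8 log 2 - 1/(x(1-x)) vanishes; it exists because 2
  -- log 2 ≥ 1. On [y, 1-y], d is convex and symmetric about its zero 1/2, hence nonnegative. On [0,
  -- y] it is concave, with d 0 = 0 and d y ≥ 0.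
  obtain ⟨y, ⟨hy0, hy1⟩, hy⟩ : ∃ y ∈ Set.Icc (0 : ℝ) (1 / 2), 2 * (4 * log 2) * (y * (1 - y)) = 1 :=
    intermediate_value_Icc (by norm_num) (by fun_prop) ⟨by norm_num, by nlinarith⟩
  have hypos : 0 < y := hy0.lt_of_ne (by rintro rfl; norm_num at hy)
  have hconvex : ConvexOn ℝ (Set.Icc y (1 - y)) d := by
    refine convexOn_of_hasDerivWithinAt2_nonneg (convex_Icc _ _) hcont.continuousOn
      (f' := fun x => log (1 - x) - log x - 4 * log 2 * (1 - 2 * x))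
      (f'' := fun x => 2 * (4 * log 2) - 1 / (x * (1 - x))) ?_ ?_ ?_ <;>
      intro t ht <;> rw [interior_Icc] at ht
    · exact (hasDerivAt_binEntropy_sub_quadratic
        ⟨by linarith [ht.1], by linarith [ht.2]⟩).hasDerivWithinAt
    · exact (hasDerivAt_log_sub_linear
        ⟨by linarith [ht.1], by linarith [ht.2]⟩).hasDerivWithinAt
    · have hty : y * (1 - y) ≤ t * (1 - t) := by
        nlinarith [mul_nonneg (sub_nonneg.2 ht.1.le) (sub_nonneg.2 ht.2.le)]
      have : 0 < t * (1 - t) := by nlinarith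
      rw [sub_nonneg, div_le_iff₀ this]
      exact hy.symm.trans_le (mul_le_mul_of_nonneg_left hty (by linarith))
  have hconcave : ConcaveOn ℝ (Set.Icc 0 y) d := by
    refine concaveOn_of_hasDerivWithinAt2_nonpos (convex_Icc _ _) hcont.continuousOn
      (f' := fun x => log (1 - x) - log x - 4 * log 2 * (1 - 2 * x))
      (f'' := fun x => 2 * (4 * log 2) - 1 / (x * (1 - x))) ?_ ?_ ?_ <;>
      intro t ht <;> rw [interior_Icc] at ht
    · exact (hasDerivAt_binEntropy_sub_quadratic
        ⟨by linarith [ht.1], by linarith [ht.2]⟩).hasDerivWithinAt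
    · exact (hasDerivAt_log_sub_linear
        ⟨by linarith [ht.1], by linarith [ht.2]⟩).hasDerivWithinAt
    · have hty : t * (1 - t) ≤ y * (1 - y) := by nlinarith [ht.1, ht.2]
      have : 0 < t * (1 - t) := mul_pos ht.1 (by linarith [ht.2])
      rw [sub_nonpos, le_div_iff₀ this]
      exact (mul_le_mul_of_nonneg_left hty (by linarith)).trans_eq hy
  have hmid : ∀ t ∈ Set.Icc y (1 / 2), 0 ≤ d t := by
    intro t ht
    have hsymm : d (1 - t) = d t := by
      simp only [d, binEntropy_one_sub]
      ring
    have := hconvex.2 (show t ∈ Set.Icc y (1 - y) from ⟨ht.1, by linarith [ht.2]⟩)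
      (show 1 - t ∈ Set.Icc y (1 - y) from ⟨by linarith [ht.2], by linarith [ht.1]⟩)
      one_half_pos.le one_half_pos.le (add_halves 1)
    simp only [smul_eq_mul, hsymm] at this
    rw [show 1 / 2 * t + 1 / 2 * (1 - t) = 1 / 2 by ring, hhalf] at this
    linarith
  rcases le_total y x with hyx | hxy
  · exact hmid x ⟨hyx, hx⟩
  · have := hconcave.2 (Set.left_mem_Icc.2 hy0) (Set.right_mem_Icc.2 hy0)
      (sub_nonneg.2 ((div_le_one hypos).2 hxy)) (div_nonneg h0 hy0) (sub_add_cancel 1 _)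
    simp only [smul_eq_mul, mul_zero, zero_add, div_mul_cancel₀ x hypos.ne'] at this
    have hd0 : d 0 = 0 := by simp [d]
    rw [hd0, mul_zero, zero_add] at this
    exact (mul_nonneg (by positivity) (hmid y ⟨le_rfl, hy1⟩)).trans this

/-! ### Optimality of θ = 1 in the two exponents -/

/-- Gibbs' inequality, for two-point weights. -/
theorem mul_log_add_le_of_nonneg {a b a₀ b₀ : ℝ} (ha : 0 ≤ a) (hb : 0 ≤ b) (ha₀ : 0 ≤ a₀)
    (hb₀ : 0 ≤ b₀) (haz : a = 0 → a₀ = 0) (hbz : b = 0 → b₀ = 0) (hpos : 0 < a₀ + b₀) :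
    (a₀ + b₀) * log (a₀ + b₀) + a₀ * (log a - log a₀) + b₀ * (log b - log b₀) ≤
      (a₀ + b₀) * log (a + b) := by
  have hab : 0 < a + b := by
    refine (add_nonneg ha hb).lt_of_ne fun h => ?_
    rw [haz (by linarith), hbz (by linarith)] at hpos
    simp at hpos
  have key : ∀ {x x₀ : ℝ}, 0 ≤ x → 0 ≤ x₀ → (x = 0 → x₀ = 0) →
      x₀ * (log x - log x₀ + log (a₀ + b₀) - log (a + b)) ≤ x * (a₀ + b₀) / (a + b) - x₀ := by
    intro x x₀ hx hx₀ hz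
    rcases hx₀.eq_or_lt with rfl | hx₀
    · simp only [zero_mul, sub_zero]
      positivity
    · have hx : 0 < x := hx.lt_of_ne fun h => hx₀.ne' (hz h.symm)
      have hlog : log x - log x₀ + log (a₀ + b₀) - log (a + b)
          = log (x * (a₀ + b₀) / (a + b) / x₀) := by
        rw [log_div (by positivity) (by positivity), log_div (by positivity) (by positivity),
          log_mul (by positivity) (by positivity)]
        ring
      rw [hlog]
      refine (mul_le_mul_of_nonneg_left (log_le_sub_one_of_pos (by positivity)) hx₀.le).trans
        (le_of_eq ?_)
      field_simp
  have h := add_le_add (key ha ha₀ haz) (key hb hb₀ hbz)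
  have : a * (a₀ + b₀) / (a + b) - a₀ + (b * (a₀ + b₀) / (a + b) - b₀) = 0 := by
    field_simp
    ring
  rw [this] at h
  linarith

theorem mul_log_rpow {x : ℝ} (hx : 0 ≤ x) (c t : ℝ) (hc : x = 0 → c = 0) :
    c * log (x ^ t) = c * (t * log x) := by
  rcases hx.eq_or_lt with h | h
  · rw [hc h.symm, zero_mul, zero_mul]
  · rw [log_rpow h]

theorem add_mul_binEntropy_div {x y : ℝ} (hx : 0 ≤ x) (hy : 0 ≤ y) (h : 0 < x + y) :
    (x + y) * binEntropy (y / (x + y)) = (x + y) * log (x + y) - x * log x - y * log y := by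
  have e : ∀ t, 0 ≤ t → (x + y) * negMulLog (t / (x + y)) = t * log (x + y) - t * log t := by
    intro t ht
    rcases ht.eq_or_lt with rfl | ht
    · simp
    · rw [negMulLog, log_div ht.ne' h.ne']
      field_simp
      ring
  have hone : 1 - y / (x + y) = x / (x + y) := by
    field_simp
    ring
  rw [binEntropy_eq_negMulLog_add_negMulLog_one_sub, hone, mul_add, e x hx, e y hy]
  ring

/-- θ log(1 + a^{1/θ}) is convex in θ with slope h(a/(1+a)) at θ = 1, so `hR` says that the concave
objective has nonpositive slope there. Gibbs' inequality with reference weights (1, a) is the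
tangent-line bound, and it also covers a = 0. -/
theorem expurgationObjective_le_one {a R θ : ℝ} (ha : 0 ≤ a) (hθ : 1 ≤ θ)
    (hR : log 2 - binEntropy (a / (1 + a)) ≤ R) :
    expurgationObjective R a θ ≤ expurgationObjective R a 1 := by
  have hθ0 : θ ≠ 0 := by linarith
  have h1a : 0 < 1 + a := by linarith
  have hent := add_mul_binEntropy_div zero_le_one ha h1a
  have hg := mul_log_add_le_of_nonneg (a := 1) (b := a ^ (1 / θ)) (a₀ := 1) (b₀ := a) zero_le_one
    (rpow_nonneg ha _) zero_le_one ha (fun h => h)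
    (fun h => ((rpow_eq_zero_iff_of_nonneg ha).1 h).1) h1a
  rw [mul_sub a, mul_log_rpow ha _ _ id] at hg
  simp only [log_one, sub_self, mul_zero, add_zero, sub_zero] at hg hent
  have hg' := mul_le_mul_of_nonneg_left hg (by linarith : 0 ≤ θ)
  have e : θ * ((1 + a) * log (1 + a) + (a * (1 / θ * log a) - a * log a))
      = (1 + a) * log (1 + a) + (θ - 1) * ((1 + a) * log (1 + a) - a * log a) := by
    field_simp
    ring
  rw [e, ← hent] at hg'
  have hfin : log (1 + a) + (θ - 1) * binEntropy (a / (1 + a)) ≤ θ * log (1 + a ^ (1 / θ)) := by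
    refine le_of_mul_le_mul_left ?_ h1a
    linarith
  have := mul_le_mul_of_nonneg_left hR (sub_nonneg.2 hθ)
  simp only [expurgationObjective, div_one, rpow_one]
  linarith

theorem psi_bscSource {ε : ℝ} (h0 : 0 ≤ ε) (h1 : ε ≤ 1) (θ : ℝ) :
    psi (bscSource ε) θ = -log ((1 - ε) ^ (1 + θ) + ε ^ (1 + θ)) := by
  have hz : ∀ z, ∑ x, bscSource ε x z = 1 / 2 := by
    intro z
    rcases zmod_two_eq z with rfl | rfl <;> simp [sum_zmod_two, bscSource] <;> ring
  have e : ∀ t : ℝ, 0 ≤ t → (t / 2) ^ (1 + θ) * (1 / 2) ^ (-θ) = t ^ (1 + θ) / 2 := by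
    intro t ht
    rw [div_eq_mul_one_div t 2, mul_rpow ht (by norm_num), mul_assoc, ← rpow_add (by norm_num)]
    simp [div_eq_mul_inv]
  simp only [psi, hz, sum_zmod_two]
  simp only [bscSource, if_true, zero_ne_one, one_ne_zero, if_false, e _ h0,
    e _ (sub_nonneg.2 h1)]
  congr 2
  ring

/-- `hR` says that this concave objective has nonnegative slope at θ = 1. The tangent bound is
Gibbs' inequality with reference weights ((1-ε)², ε²). -/
theorem hayashiObjective_bscSource_le_one {ε R θ : ℝ} (h0 : 0 ≤ ε) (h1 : ε ≤ 1)
    (hθ1 : θ ≤ 1)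
    (hR : 2 * R ≤ binEntropy (ε ^ 2 / ((1 - ε) ^ 2 + ε ^ 2)) - log ((1 - ε) ^ 2 + ε ^ 2)) :
    hayashiObjective (bscSource ε) R θ ≤ hayashiObjective (bscSource ε) R 1 := by
  have h1' : 0 ≤ 1 - ε := sub_nonneg.2 h1
  have hN : 0 < (1 - ε) ^ 2 + ε ^ 2 := by nlinarith [sq_nonneg (1 - 2 * ε)]
  have hent := add_mul_binEntropy_div (sq_nonneg (1 - ε)) (sq_nonneg ε) hN
  have hz : ∀ t : ℝ, 0 ≤ t → t ^ (1 + θ) = 0 → t ^ 2 = 0 := fun t ht h => by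
    rw [((rpow_eq_zero_iff_of_nonneg ht).1 h).1]
    norm_num
  have hg := mul_log_add_le_of_nonneg (a := (1 - ε) ^ (1 + θ)) (b := ε ^ (1 + θ))
    (a₀ := (1 - ε) ^ 2) (b₀ := ε ^ 2) (rpow_nonneg h1' _) (rpow_nonneg h0 _) (sq_nonneg _)
    (sq_nonneg _) (hz _ h1') (hz _ h0) hN
  rw [mul_sub, mul_sub, mul_log_rpow h1' _ _ (fun h => by rw [h]; norm_num),
    mul_log_rpow h0 _ _ (fun h => by rw [h]; norm_num)] at hg
  simp only [log_pow, Nat.cast_ofNat] at hg hent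
  have hfin : log ((1 - ε) ^ 2 + ε ^ 2) + (1 - θ) / 2 *
      (binEntropy (ε ^ 2 / ((1 - ε) ^ 2 + ε ^ 2)) - log ((1 - ε) ^ 2 + ε ^ 2))
        ≤ log ((1 - ε) ^ (1 + θ) + ε ^ (1 + θ)) := by
    refine le_of_mul_le_mul_left ?_ hN
    have e : ((1 - ε) ^ 2 + ε ^ 2) * (log ((1 - ε) ^ 2 + ε ^ 2) + (1 - θ) / 2 *
        (binEntropy (ε ^ 2 / ((1 - ε) ^ 2 + ε ^ 2)) - log ((1 - ε) ^ 2 + ε ^ 2)))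
        = ((1 - ε) ^ 2 + ε ^ 2) * log ((1 - ε) ^ 2 + ε ^ 2) + (1 - θ) / 2 *
          (((1 - ε) ^ 2 + ε ^ 2) * binEntropy (ε ^ 2 / ((1 - ε) ^ 2 + ε ^ 2))
            - ((1 - ε) ^ 2 + ε ^ 2) * log ((1 - ε) ^ 2 + ε ^ 2)) := by ring
    rw [e, hent]
    linarith
  have := mul_le_mul_of_nonneg_left hR (sub_nonneg.2 hθ1)
  have e2 : (1 : ℝ) + 1 = (2 : ℕ) := by norm_num
  simp only [hayashiObjective, psi_bscSource h0 h1, e2, rpow_natCast]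
  linarith

/-- An entropic uncertainty relation for the two pairs of weights `(1, (1 - 2ε)²)` and
`((1 - ε)², ε²)`. -/
theorem log_two_le_binEntropy_add (ε : ℝ) :
    log 2 ≤ binEntropy ((1 - 4 * ε * (1 - ε)) / (1 + (1 - 4 * ε * (1 - ε))))
      + binEntropy (ε ^ 2 / ((1 - ε) ^ 2 + ε ^ 2)) := by
  have ha : 0 ≤ 1 - 4 * ε * (1 - ε) := by nlinarith [sq_nonneg (1 - 2 * ε)]
  have h1a : 0 < 1 + (1 - 4 * ε * (1 - ε)) := by linarith
  have hN : 0 < (1 - ε) ^ 2 + ε ^ 2 := by nlinarith [sq_nonneg (1 - 2 * ε)]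
  have hb := log_two_mul_le_binEntropy (div_nonneg ha h1a.le) ((div_le_one h1a).2 (by linarith))
  have hr := log_two_mul_le_binEntropy (div_nonneg (sq_nonneg ε) hN.le)
    ((div_le_one hN).2 (by linarith [sq_nonneg (1 - ε)]))
  -- With x and y the two arguments of h, x(1-x) + y(1-y) is exactly 1/4, so the two quadratic
  -- bounds add up to log 2.
  refine le_trans (le_of_eq ?_) (add_le_add hb hr)
  have e : 1 + (1 - 4 * ε * (1 - ε)) = 2 * ((1 - ε) ^ 2 + ε ^ 2) := by ring
  rw [e]
  field_simp
  ring

/-- This compares the slope thresholds of the two objectives at θ = 1. Beyond the uncertainty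
relation it needs only h(a/(1+a)) ≥ log(1+a), which holds since -a log a ≥ 0 for 0 ≤ a ≤ 1. -/
theorem two_mul_log_two_sub_le {ε : ℝ} (h0 : 0 ≤ ε) (h1 : ε ≤ 1) :
    2 * (log 2 - binEntropy ((1 - 4 * ε * (1 - ε)) / (1 + (1 - 4 * ε * (1 - ε))))) ≤
      binEntropy (ε ^ 2 / ((1 - ε) ^ 2 + ε ^ 2)) - log ((1 - ε) ^ 2 + ε ^ 2) := by
  have ha : 0 ≤ 1 - 4 * ε * (1 - ε) := by nlinarith [sq_nonneg (1 - 2 * ε)]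
  have ha1 : 1 - 4 * ε * (1 - ε) ≤ 1 := by nlinarith
  have hN : 0 < (1 - ε) ^ 2 + ε ^ 2 := by nlinarith [sq_nonneg (1 - 2 * ε)]
  have hlog : log ((1 - ε) ^ 2 + ε ^ 2) = log (1 + (1 - 4 * ε * (1 - ε))) - log 2 := by
    rw [show 1 + (1 - 4 * ε * (1 - ε)) = 2 * ((1 - ε) ^ 2 + ε ^ 2) by ring,
      log_mul (by norm_num) hN.ne']
    ring
  have hunc := log_two_le_binEntropy_add ε
  rw [hlog]
  generalize 1 - 4 * ε * (1 - ε) = a at *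
  have h1a : 0 < 1 + a := by linarith
  have hent := add_mul_binEntropy_div zero_le_one ha h1a
  have hmin : log (1 + a) ≤ binEntropy (a / (1 + a)) := by
    refine le_of_mul_le_mul_left ?_ h1a
    rw [hent, log_one]
    have := mul_nonneg_of_nonpos_of_nonpos (neg_nonpos.2 ha) (log_nonpos ha ha1)
    linarith
  linarith

/-! ### The expurgation and critical rates -/

theorem isClosed_expurgationTightRates (ε : ℝ) : IsClosed (expurgationTightRates ε) := by
  simp only [expurgationTightRates, isMaxOn_iff, expurgationObjective, Set.ofPred_and,
    Set.ofPred_forall]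
  refine isClosed_Ici.inter (isClosed_biInter fun θ _ => ?_)
  exact isClosed_le (by fun_prop) (by fun_prop)

theorem isClosed_hayashiTightRates (ε : ℝ) : IsClosed (hayashiTightRates ε) := by
  simp only [hayashiTightRates, isMaxOn_iff, hayashiObjective, Set.ofPred_and,
    Set.ofPred_forall]
  refine isClosed_Ici.inter (isClosed_biInter fun θ _ => ?_)
  exact isClosed_le (by fun_prop) (by fun_prop)

/-- Raising R penalizes θ > 1 more than θ = 1, as R enters only through -θR. For Hayashi's objective
θ ≤ 1, so the monotonicity reverses. -/
theorem expurgationTightRates_upward {ε R R' : ℝ} (hR : R ∈ expurgationTightRates ε)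
    (h : R ≤ R') : R' ∈ expurgationTightRates ε := by
  refine ⟨hR.1.trans h, isMaxOn_iff.2 fun θ hθ => ?_⟩
  have := isMaxOn_iff.1 hR.2 θ hθ
  have := mul_le_mul_of_nonneg_left h (sub_nonneg.2 (Set.mem_Ici.1 hθ))
  simp only [expurgationObjective] at *
  linarith

theorem hayashiTightRates_downward {ε R R' : ℝ} (hR : R ∈ hayashiTightRates ε)
    (h0 : 0 ≤ R') (h : R' ≤ R) : R' ∈ hayashiTightRates ε := by
  refine ⟨h0, isMaxOn_iff.2 fun θ hθ => ?_⟩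
  have := isMaxOn_iff.1 hR.2 θ hθ
  have := mul_le_mul_of_nonneg_left h (sub_nonneg.2 hθ.2)
  simp only [hayashiObjective] at *
  linarith

/-- The witness is R = log 2 - h(a/(1+a)), the rate at which the slope of the expurgation objective
vanishes at θ = 1. -/
theorem exists_mem_tightRates {ε : ℝ} (h0 : 0 ≤ ε) (h1 : ε ≤ 1) :
    ∃ R, R ∈ expurgationTightRates ε ∧ R ∈ hayashiTightRates ε := by
  have ha : 0 ≤ 1 - 4 * ε * (1 - ε) := by nlinarith [sq_nonneg (1 - 2 * ε)]
  have hR := sub_nonneg.2 (binEntropy_le_log_two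
    (p := (1 - 4 * ε * (1 - ε)) / (1 + (1 - 4 * ε * (1 - ε)))))
  exact ⟨_, ⟨hR, isMaxOn_iff.2 fun θ hθ => expurgationObjective_le_one ha hθ le_rfl⟩,
    ⟨hR, isMaxOn_iff.2 fun θ hθ => hayashiObjective_bscSource_le_one h0 h1 hθ.2
      (two_mul_log_two_sub_le h0 h1)⟩⟩

theorem isLeast_expurgationRate {ε : ℝ} (h0 : 0 ≤ ε) (h1 : ε ≤ 1) :
    IsLeast (expurgationTightRates ε) (expurgationRate ε) :=
  (isClosed_expurgationTightRates ε).isLeast_csInf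
    ((exists_mem_tightRates h0 h1).imp fun _ h => h.1) ⟨0, fun _ h => h.1⟩

theorem isGreatest_criticalRate {ε : ℝ} (h0 : 0 ≤ ε) (h1 : ε ≤ 1) :
    IsGreatest (hayashiTightRates ε) (criticalRate ε) := by
  refine (isClosed_hayashiTightRates ε).isGreatest_csSup
    ((exists_mem_tightRates h0 h1).imp fun _ h => h.2)
    -- Comparing θ = 1 with θ = 0 bounds every tight rate.
    ⟨psi (bscSource ε) 1 - psi (bscSource ε) 0, fun R hR => ?_⟩
  have := isMaxOn_iff.1 hR.2 0 (by simp)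
  simp only [hayashiObjective] at this
  linarith

theorem expurgationRate_pos {ε : ℝ} (h0 : 0 < ε) (h1 : ε < 1) : 0 < expurgationRate ε := by
  have hleast := (isLeast_expurgationRate h0.le h1.le).1
  refine hleast.1.lt_of_ne fun h => ?_
  rw [← h] at hleast
  have ha : 0 ≤ 1 - 4 * ε * (1 - ε) := by nlinarith [sq_nonneg (1 - 2 * ε)]
  have ha1 : 1 - 4 * ε * (1 - ε) < 1 := by nlinarith [mul_pos h0 (sub_pos.2 h1)]
  -- At R = 0, θ = 2 strictly beats θ = 1: (1 + √a)² < 2(1 + a) whenever √a ≠ 1.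
  have := isMaxOn_iff.1 hleast.2 2 (by norm_num)
  simp only [expurgationObjective, div_one, rpow_one, ← sqrt_eq_rpow] at this
  generalize 1 - 4 * ε * (1 - ε) = a at *
  have hs := sqrt_nonneg a
  have hs1 : √a < 1 := by rwa [sqrt_lt' one_pos, one_pow]
  have hsq : √a ^ 2 = a := sq_sqrt ha
  have hlt : log ((1 + √a) ^ 2) < log (2 * (1 + a)) :=
    log_lt_log (by positivity) (by nlinarith [sq_pos_of_pos (sub_pos.2 hs1)])
  rw [log_pow, log_mul (by norm_num) (by positivity)] at hlt
  push_cast at hlt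
  linarith

theorem expurgationExponent_eq_of_mem {ε R : ℝ} (hR : R ∈ expurgationTightRates ε) :
    expurgationExponent R (1 - 4 * ε * (1 - ε))
      = (expurgationObjective R (1 - 4 * ε * (1 - ε)) 1 : EReal) :=
  le_antisymm (iSup₂_le fun θ hθ => EReal.coe_le_coe_iff.2 (isMaxOn_iff.1 hR.2 θ hθ))
    (le_iSup₂_of_le 1 Set.self_mem_Ici le_rfl)

theorem hayashiExponent_eq_of_mem {ε R : ℝ} (hR : R ∈ hayashiTightRates ε) :
    hayashiExponent (bscSource ε) R = (hayashiObjective (bscSource ε) R 1 : EReal) :=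
  le_antisymm (iSup₂_le fun θ hθ => EReal.coe_le_coe_iff.2 (isMaxOn_iff.1 hR.2 θ hθ))
    (le_iSup₂_of_le 1 (by simp) le_rfl)

theorem objectives_eq_at_one {ε : ℝ} (h0 : 0 ≤ ε) (h1 : ε ≤ 1) (R : ℝ) :
    expurgationObjective R (1 - 4 * ε * (1 - ε)) 1 = hayashiObjective (bscSource ε) R 1 := by
  have hN : 0 < (1 - ε) ^ 2 + ε ^ 2 := by nlinarith [sq_nonneg (1 - 2 * ε)]
  have e2 : (1 : ℝ) + 1 = (2 : ℕ) := by norm_num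
  simp only [expurgationObjective, hayashiObjective, psi_bscSource h0 h1, div_one, rpow_one, e2,
    rpow_natCast]
  rw [show 1 + (1 - 4 * ε * (1 - ε)) = 2 * ((1 - ε) ^ 2 + ε ^ 2) by ring,
    log_mul (by norm_num) hN.ne']
  ring

end PrivacyAmp

theorem theorem2 (ε : ℝ) (hε0 : 0 ≤ ε) (hε1 : ε ≤ 1) :
    -- reduction to the erasure channel and the resulting bound, for the sequences with uniform
    -- keys, for the linear sequences, and for all sequences
    (∀ 𝒞 ∈ ({PrivacyAmp.HashSequence.uniformKey, PrivacyAmp.HashSequence.linear, Set.univ} :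
        Set (Set PrivacyAmp.HashSequence)),
      ∀ R : ℝ, 0 ≤ R → R ≤ Real.log 2 →
        PrivacyAmp.optimalExponent 𝒞 (PrivacyAmp.becSource (4 * ε * (1 - ε))) R
            ≤ PrivacyAmp.optimalExponent 𝒞 (PrivacyAmp.bscSource ε) R ∧
        PrivacyAmp.expurgationExponent R (1 - 4 * ε * (1 - ε))
            ≤ PrivacyAmp.optimalExponent 𝒞 (PrivacyAmp.becSource (4 * ε * (1 - ε))) R) ∧
    -- the expurgation rate and the critical rate
    IsLeast (PrivacyAmp.expurgationTightRates ε) (PrivacyAmp.expurgationRate ε) ∧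
    IsGreatest (PrivacyAmp.hayashiTightRates ε) (PrivacyAmp.criticalRate ε) ∧
    PrivacyAmp.expurgationRate ε ≤ PrivacyAmp.criticalRate ε ∧
    (0 < ε → ε < 1 → 0 < PrivacyAmp.expurgationRate ε) ∧
    -- comparison with Hayashi's exponent
    (∀ R : ℝ, PrivacyAmp.expurgationRate ε ≤ R → R ≤ PrivacyAmp.criticalRate ε →
      PrivacyAmp.expurgationExponent R (1 - 4 * ε * (1 - ε))
        = PrivacyAmp.hayashiExponent (PrivacyAmp.bscSource ε) R) ∧
    (∀ R : ℝ, 0 ≤ R → R < PrivacyAmp.expurgationRate ε →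
      PrivacyAmp.hayashiExponent (PrivacyAmp.bscSource ε) R
        < PrivacyAmp.expurgationExponent R (1 - 4 * ε * (1 - ε))) := by
  have hδ0 : 0 ≤ 4 * ε * (1 - ε) := by nlinarith
  have hδ1 : 4 * ε * (1 - ε) ≤ 1 := by nlinarith [sq_nonneg (1 - 2 * ε)]
  have hleast := PrivacyAmp.isLeast_expurgationRate hε0 hε1
  have hgreatest := PrivacyAmp.isGreatest_criticalRate hε0 hε1
  have hle : PrivacyAmp.expurgationRate ε ≤ PrivacyAmp.criticalRate ε := by
    obtain ⟨R, hRx, hRcr⟩ := PrivacyAmp.exists_mem_tightRates hε0 hε1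
    exact (hleast.2 hRx).trans (hgreatest.2 hRcr)
  refine ⟨fun C hC R hR0 hR1 => ⟨PrivacyAmp.optimalExponent_bec_le_bsc hε0 hε1 C R,
      PrivacyAmp.expurgationExponent_le_optimalExponent hδ0 hδ1 hR0 hR1 ?_⟩,
    hleast, hgreatest, hle, PrivacyAmp.expurgationRate_pos, fun R hx hcr => ?_,
    fun R hR0 hR => ?_⟩
  · rcases hC with rfl | rfl | rfl
    · exact PrivacyAmp.linear_subset_uniformKey
    · exact subset_rfl
    · exact Set.subset_univ _
  · rw [PrivacyAmp.expurgationExponent_eq_of_mem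
        (PrivacyAmp.expurgationTightRates_upward hleast.1 hx),
      PrivacyAmp.hayashiExponent_eq_of_mem
        (PrivacyAmp.hayashiTightRates_downward hgreatest.1 (hleast.1.1.trans hx) hcr),
      PrivacyAmp.objectives_eq_at_one hε0 hε1]
  · rw [PrivacyAmp.hayashiExponent_eq_of_mem
        (PrivacyAmp.hayashiTightRates_downward hgreatest.1 hR0 (hR.le.trans hle)),
      ← PrivacyAmp.objectives_eq_at_one hε0 hε1]
    -- Below the least tight rate some θ > 1 strictly beats θ = 1, whose value is already Hayashi's
    -- exponent.
    have hnot : R ∉ PrivacyAmp.expurgationTightRates ε := fun h => hR.not_ge (hleast.2 h)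
    simp only [PrivacyAmp.expurgationTightRates, Set.mem_ofPred_eq, hR0, true_and, isMaxOn_iff,
      not_forall, not_le] at hnot
    obtain ⟨θ, hθ, hlt⟩ := hnot
    exact (EReal.coe_lt_coe_iff.2 hlt).trans_le (le_iSup₂_of_le θ hθ le_rfl)
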